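/- Let $N>1$ be an integer, let $\mathbb{Q}_N=\{p/N^k : p\in\mathbb{Z},\,k\in\mathbb{N}\}$ be the discrete additive group of $N$-adic rationals, and let $\mathscr{S}_N=\{(z_n)_{n\in\mathbb{N}}\in\mathbb{T}^{\mathbb{N}} : z_{n+1}^N=z_n \text{ for all } n\}$ be the solenoid group, which is the Pontryagin dual of $\mathbb{Q}_N$ for the pairing $\langle p/N^k,(z_n)_n\rangle = z_k^{\,p}$. Let $$\Xi_N=\Big\{(\alpha_n)_{n\in\mathbb{N}}\in\mathbb{R}^{\mathbb{N}} : \alpha_0\in[0,1)\ \text{and for every } n \text{ there is } k\in\{0,\dots,N-1\} \text{ with } N\alpha_{n+1}=\alpha_n+k\Big\}.$$ For $\alpha\in\Xi_N$ let $\Psi_\alpha$ be the multiplier of $\mathbb{Q}_N^2$ given by $$\Psi_\alpha\Big(\big(\tfrac{p_1}{N^{k_1}},\tfrac{p_2}{N^{k_2}}\big),\big(\tfrac{p_3}{N^{k_3}},\tfrac{p_4}{N^{k_4}}\big)\Big)=\exp\big(2\pi i\,\alpha_{k_1+k_4}\,p_1p_4\big),$$ and let $\mathscr{A}^{\mathscr{S}}_\alpha=C^*(\mathbb{Q}_N^2,\Psi_\alpha)$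 be the twisted group C*-algebra (the noncommutative solenoid), i.e. the universal C*-algebra generated by unitaries $W_g$, $g\in\mathbb{Q}_N^2$, with $W_gW_h=\Psi_\alpha(g,h)W_{g+h}$. The dual action of $\mathscr{S}_N^2$ on $\mathscr{A}^{\mathscr{S}}_\alpha$ is the action by $*$-automorphisms determined by $(z,w)\cdot W_{(x,y)}=\langle x,z\rangle\langle y,w\rangle W_{(x,y)}$. Theorem. For every integer $N>1$ and every $\alpha\in\Xi_N$, the C*-algebra $\mathscr{A}^{\mathscr{S}}_\alpha$ has a tracial state $\tau$ that is invariant under the dual action of $\mathscr{S}_N^2$. Moreover, if $\mathscr{A}^{\mathscr{S}}_\alpha$ is simple (it has no nontrivial closed two-sided ideal), then $\tau$ is the only tracial state of $\mathscr{A}^{\mathscr{S}}_\alpha$. -/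

import Mathlib

noncomputable section

/-! ### Twisted group C*-algebras of discrete groups -/

/-- A normalized circle-valued multiplier (2-cocycle) on a discrete group, written additively. -/
structure Multiplier (G : Type*) [AddGroup G] where
  toFun : G → G → Circle
  zero_left : ∀ x, toFun 0 x = 1
  zero_right : ∀ x, toFun x 0 = 1
  cocycle : ∀ x y z, toFun x y * toFun (x + y) z = toFun x (y + z) * toFun y z

instance {G : Type*} [AddGroup G] : CoeFun (Multiplier G) (fun _ => G → G → Circle) :=
  ⟨Multiplier.toFun⟩

/-- The twisted group *-algebra of finitely supported functions on `G`: its basis vectors `δ x`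
multiply by `δ x * δ y = σ x y • δ (x + y)` and are unitary. -/
def TwistedGroupAlgebra {G : Type*} [AddGroup G] (_σ : Multiplier G) : Type _ := G →₀ ℂ

namespace TwistedGroupAlgebra

variable {G : Type*} [AddGroup G] {σ : Multiplier G}

instance : AddCommGroup (TwistedGroupAlgebra σ) := inferInstanceAs (AddCommGroup (G →₀ ℂ))
instance : Module ℂ (TwistedGroupAlgebra σ) := inferInstanceAs (Module ℂ (G →₀ ℂ))

/-- The basis vector at `x`. -/
def δ (x : G) : TwistedGroupAlgebra σ := (Finsupp.single x (1 : ℂ) : G →₀ ℂ)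

/-- The linear extension of a map given on the basis vectors. -/
def extend {M : Type*} [AddCommGroup M] [Module ℂ M] (f : G → M) :
    TwistedGroupAlgebra σ →ₗ[ℂ] M :=
  Finsupp.linearCombination ℂ f

@[simp] theorem extend_δ {M : Type*} [AddCommGroup M] [Module ℂ M] (f : G → M) (x : G) :
    extend (σ := σ) f (δ x) = f x := by
  exact (Finsupp.linearCombination_single ℂ (1 : ℂ) x).trans (one_smul ℂ (f x))

theorem hom_ext {M : Type*} [AddCommGroup M] [Module ℂ M]
    {f g : TwistedGroupAlgebra σ →ₗ[ℂ] M} (h : ∀ x, f (δ x) = g (δ x)) : f = g :=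
  Finsupp.lhom_ext' (M := ℂ) fun x => LinearMap.ext_ring (h x)

@[elab_as_elim]
theorem induction_on {P : TwistedGroupAlgebra σ → Prop} (a : TwistedGroupAlgebra σ)
    (zero : P 0) (add : ∀ a b, P a → P b → P (a + b)) (smul : ∀ (c : ℂ) x, P (c • δ x)) : P a := by
  refine Finsupp.induction_linear (motive := P) a zero add fun x c => ?_
  have h : (Finsupp.single x c : G →₀ ℂ) = c • Finsupp.single x (1 : ℂ) := by simp
  rw [h]
  exact smul c x

/-- The twisted convolution product as a bilinear map. -/
def mulLin : TwistedGroupAlgebra σ →ₗ[ℂ] TwistedGroupAlgebra σ →ₗ[ℂ] TwistedGroupAlgebra σ :=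
  extend fun x => extend fun y => (σ x y : ℂ) • δ (x + y)

/-- The involution `f ↦ f*`, determined by `(c • δ x)* = conj (c * σ x (-x)) • δ (-x)`. -/
def starFun (a : TwistedGroupAlgebra σ) : TwistedGroupAlgebra σ :=
  Finsupp.sum a fun x c => starRingEnd ℂ (c * σ x (-x)) • δ (-x)

instance : Mul (TwistedGroupAlgebra σ) := ⟨fun a b => mulLin a b⟩
instance : One (TwistedGroupAlgebra σ) := ⟨δ 0⟩
instance : Star (TwistedGroupAlgebra σ) := ⟨starFun⟩

theorem mul_def (a b : TwistedGroupAlgebra σ) : a * b = mulLin a b := rfl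
theorem one_def : (1 : TwistedGroupAlgebra σ) = δ 0 := rfl

theorem δ_mul_δ (x y : G) : (δ x * δ y : TwistedGroupAlgebra σ) = (σ x y : ℂ) • δ (x + y) := by
  simp [mul_def, mulLin]

theorem smul_mul' (c : ℂ) (a b : TwistedGroupAlgebra σ) : (c • a) * b = c • (a * b) := by
  simp [mul_def]

theorem mul_smul' (c : ℂ) (a b : TwistedGroupAlgebra σ) : a * (c • b) = c • (a * b) := by
  simp [mul_def]

theorem add_mul' (a b c : TwistedGroupAlgebra σ) : (a + b) * c = a * c + b * c := by
  simp [mul_def]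

theorem mul_add' (a b c : TwistedGroupAlgebra σ) : a * (b + c) = a * b + a * c := by
  simp [mul_def]

theorem zero_mul' (a : TwistedGroupAlgebra σ) : 0 * a = 0 := by
  simp [mul_def]

theorem mul_zero' (a : TwistedGroupAlgebra σ) : a * 0 = 0 := by
  simp [mul_def]

theorem mul_assoc' (a b c : TwistedGroupAlgebra σ) : (a * b) * c = a * (b * c) := by
  refine induction_on a (by simp only [zero_mul']) (fun a a' h h' => by simp only [add_mul', h, h']) ?_
  intro r x
  refine induction_on b (by simp only [zero_mul', mul_zero'])
    (fun b b' h h' => by simp only [add_mul', mul_add', h, h']) ?_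
  intro s y
  refine induction_on c (by simp only [mul_zero']) (fun c c' h h' => by simp only [mul_add', h, h']) ?_
  intro t z
  simp only [smul_mul', mul_smul', δ_mul_δ, smul_smul, add_assoc]
  congr 1
  have h := congrArg (fun u : Circle => (u : ℂ)) (σ.cocycle x y z)
  simp only [Circle.coe_mul] at h
  linear_combination (r * s * t) * h

instance : Ring (TwistedGroupAlgebra σ) :=
  { (inferInstance : AddCommGroup (TwistedGroupAlgebra σ)),
    (inferInstance : Mul (TwistedGroupAlgebra σ)),
    (inferInstance : One (TwistedGroupAlgebra σ)) with
    left_distrib := mul_add'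
    right_distrib := add_mul'
    zero_mul := zero_mul'
    mul_zero := mul_zero'
    mul_assoc := mul_assoc'
    one_mul := fun a => by
      refine induction_on a (mul_zero' _) (fun a b h h' => by rw [mul_add', h, h']) ?_
      intro c x
      rw [one_def, mul_smul', δ_mul_δ, σ.zero_left]; simp
    mul_one := fun a => by
      refine induction_on a (zero_mul' _) (fun a b h h' => by rw [add_mul', h, h']) ?_
      intro c x
      rw [one_def, smul_mul', δ_mul_δ, σ.zero_right]; simp }

instance : Algebra ℂ (TwistedGroupAlgebra σ) := Algebra.ofModule smul_mul' mul_smul'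

theorem star_add' (a b : TwistedGroupAlgebra σ) : star (a + b) = star a + star b := by
  refine Finsupp.sum_add_index' (M := ℂ) (h := fun x c => starRingEnd ℂ (c * σ x (-x)) •
    (δ (-x) : TwistedGroupAlgebra σ)) (fun x => ?_) (fun x c d => ?_)
  · simp
  · rw [add_mul, map_add, add_smul]

theorem star_zero' : star (0 : TwistedGroupAlgebra σ) = 0 := by
  have h := star_add' (0 : TwistedGroupAlgebra σ) 0
  simpa using h

theorem star_smul_δ (c : ℂ) (x : G) : star (c • δ x : TwistedGroupAlgebra σ) =
    starRingEnd ℂ (c * σ x (-x)) • δ (-x) := by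
  have h : (c • δ x : TwistedGroupAlgebra σ) = (Finsupp.single x c : G →₀ ℂ) := by
    exact Finsupp.smul_single_one x c
  rw [h]
  exact Finsupp.sum_single_index (h := fun y d => starRingEnd ℂ (d * σ y (-y)) •
    (δ (-y) : TwistedGroupAlgebra σ)) (by rw [zero_mul, map_zero, zero_smul])

theorem star_smul' (c : ℂ) (a : TwistedGroupAlgebra σ) :
    star (c • a) = starRingEnd ℂ c • star a := by
  refine induction_on a (by rw [smul_zero, star_zero', smul_zero])
    (fun a b h h' => by rw [smul_add, star_add', h, h', star_add', smul_add]) ?_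
  intro d x
  rw [smul_smul, star_smul_δ, star_smul_δ, smul_smul, mul_assoc, map_mul]

theorem star_δ (x : G) : star (δ x : TwistedGroupAlgebra σ) =
    starRingEnd ℂ (σ x (-x)) • δ (-x) := by
  simpa using star_smul_δ (σ := σ) 1 x

theorem multiplier_neg (x : G) : σ (-x) x = σ x (-x) := by
  have h := σ.cocycle x (-x) x
  simp only [add_neg_cancel, neg_add_cancel, σ.zero_left, σ.zero_right, mul_one, one_mul] at h
  exact h.symm

theorem multiplier_star (x y : G) :
    σ x y * σ (x + y) (-(x + y)) * σ (-y) (-x) = σ x (-x) * σ y (-y) := by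
  have h₁ := σ.cocycle x y (-(x + y))
  have h₂ := σ.cocycle y (-y) (-x)
  simp only [neg_add_rev, add_neg_cancel, add_neg_cancel_left, σ.zero_left, mul_one] at h₁ h₂ ⊢
  rw [h₁, h₂, mul_assoc]

theorem coe_mul_conj (z : Circle) : (z : ℂ) * starRingEnd ℂ (z : ℂ) = 1 := by
  rw [Complex.mul_conj, Circle.normSq_coe, Complex.ofReal_one]

theorem star_δ_mul (x y : G) :
    star (δ x * δ y : TwistedGroupAlgebra σ) = star (δ y) * star (δ x) := by
  rw [δ_mul_δ, star_smul_δ, star_δ, star_δ, smul_mul', mul_smul', δ_mul_δ, smul_smul, smul_smul,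
    neg_add_rev]
  congr 1
  have h := congrArg (fun u : Circle => (u : ℂ)) (multiplier_star (σ := σ) x y)
  simp only [Circle.coe_mul] at h
  have h' := congrArg (starRingEnd ℂ) h
  simp only [map_mul, neg_add_rev] at h' ⊢
  have h₁ := coe_mul_conj (σ (-y) (-x))
  calc starRingEnd ℂ (σ x y) * starRingEnd ℂ (σ (x + y) (-y + -x))
      = (starRingEnd ℂ (σ x y) * starRingEnd ℂ (σ (x + y) (-y + -x)) *
        starRingEnd ℂ (σ (-y) (-x))) * σ (-y) (-x) := by
        linear_combination
          (-(starRingEnd ℂ (σ x y) * starRingEnd ℂ (σ (x + y) (-y + -x)))) * h₁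
    _ = _ := by rw [h']; ring

instance : StarRing (TwistedGroupAlgebra σ) where
  star_add := star_add'
  star_involutive a := by
    refine induction_on a (by simp [star_zero']) (fun a b h h' => by
      rw [star_add', star_add', h, h']) ?_
    intro c x
    rw [star_smul_δ, star_smul_δ, neg_neg, multiplier_neg]
    congr 1
    simp only [map_mul, Complex.conj_conj]
    rw [mul_assoc, coe_mul_conj, mul_one]
  star_mul a b := by
    refine induction_on a (by simp [star_zero']) (fun a a' h h' => by
      rw [add_mul, star_add', h, h', star_add', mul_add]) ?_
    intro c x
    refine induction_on b (by simp [star_zero']) (fun b b' h h' => by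
      rw [mul_add, star_add', h, h', star_add', add_mul]) ?_
    intro d y
    rw [smul_mul', mul_smul', smul_smul, star_smul', star_smul', star_smul', star_δ_mul, smul_mul',
      mul_smul', smul_smul, map_mul, mul_comm]

instance : StarModule ℂ (TwistedGroupAlgebra σ) where
  star_smul := star_smul'

theorem star_δ_mul_self (x : G) : star (δ x : TwistedGroupAlgebra σ) * δ x = 1 := by
  rw [star_δ, smul_mul', δ_mul_δ, smul_smul, multiplier_neg, mul_comm, coe_mul_conj, one_smul,
    neg_add_cancel, one_def]

theorem δ_mul_star_self (x : G) : (δ x : TwistedGroupAlgebra σ) * star (δ x) = 1 := by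
  rw [star_δ, mul_smul', δ_mul_δ, smul_smul, mul_comm, coe_mul_conj, one_smul,
    add_neg_cancel, one_def]

variable (σ)

/-- The C*-seminorms on the twisted group *-algebra. -/
def cstarSeminorms : Set (Seminorm ℂ (TwistedGroupAlgebra σ)) :=
  {p | (∀ a b, p (a * b) ≤ p a * p b) ∧ ∀ a, p (star a * a) = p a * p a}

variable {σ}

theorem seminorm_δ_le {p : Seminorm ℂ (TwistedGroupAlgebra σ)} (hp : p ∈ cstarSeminorms σ) (x : G) :
    p (δ x) ≤ 1 := by
  have h₁ : p 1 = p 1 * p 1 := by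
    have := hp.2 1
    rwa [star_one, one_mul] at this
  have hx := hp.2 (δ x)
  rw [star_δ_mul_self] at hx
  have h₁' : p 1 ≤ 1 := by nlinarith [apply_nonneg p 1]
  nlinarith [apply_nonneg p (δ x)]

theorem zero_mem_cstarSeminorms : (0 : Seminorm ℂ (TwistedGroupAlgebra σ)) ∈ cstarSeminorms σ := by
  simp [cstarSeminorms]

theorem exists_bound (a : TwistedGroupAlgebra σ) : ∃ C, ∀ p ∈ cstarSeminorms σ, p a ≤ C := by
  refine induction_on a ⟨0, fun p _ => by simp⟩ ?_ ?_
  · rintro a b ⟨C, hC⟩ ⟨D, hD⟩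
    exact ⟨C + D, fun p hp => (map_add_le_add p a b).trans (add_le_add (hC p hp) (hD p hp))⟩
  · intro c x
    refine ⟨‖c‖, fun p hp => ?_⟩
    rw [map_smul_eq_mul]
    exact mul_le_of_le_one_right (norm_nonneg c) (seminorm_δ_le hp x)

theorem bddAbove_cstarSeminorms : BddAbove (cstarSeminorms σ) := by
  rw [Seminorm.bddAbove_iff]
  choose C hC using exists_bound (σ := σ)
  refine ⟨C, ?_⟩
  rintro _ ⟨p, hp, rfl⟩ a
  exact hC a p hp

variable (σ) in
/-- The largest C*-seminorm: the pointwise supremum of all C*-seminorms. -/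
def maxSeminorm : Seminorm ℂ (TwistedGroupAlgebra σ) := sSup (cstarSeminorms σ)

theorem le_maxSeminorm {p : Seminorm ℂ (TwistedGroupAlgebra σ)} (hp : p ∈ cstarSeminorms σ)
    (a : TwistedGroupAlgebra σ) : p a ≤ maxSeminorm σ a :=
  le_csSup bddAbove_cstarSeminorms hp a

theorem maxSeminorm_le {a : TwistedGroupAlgebra σ} {C : ℝ}
    (h : ∀ p ∈ cstarSeminorms σ, p a ≤ C) : maxSeminorm σ a ≤ C := by
  rw [maxSeminorm, Seminorm.sSup_apply bddAbove_cstarSeminorms]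
  have : Nonempty (cstarSeminorms σ) := ⟨⟨0, zero_mem_cstarSeminorms⟩⟩
  exact ciSup_le fun p => h p p.2

theorem maxSeminorm_mem : maxSeminorm σ ∈ cstarSeminorms σ := by
  have hmul : ∀ a b, maxSeminorm σ (a * b) ≤ maxSeminorm σ a * maxSeminorm σ b := fun a b =>
    maxSeminorm_le fun p hp => (hp.1 a b).trans
      (mul_le_mul (le_maxSeminorm hp a) (le_maxSeminorm hp b) (apply_nonneg p b)
        (apply_nonneg _ a))
  refine ⟨hmul, fun a => le_antisymm (maxSeminorm_le fun p hp => ?_) ?_⟩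
  · rw [hp.2]
    exact mul_le_mul (le_maxSeminorm hp a) (le_maxSeminorm hp a) (apply_nonneg p a)
      (apply_nonneg _ a)
  · have h : maxSeminorm σ a ≤ Real.sqrt (maxSeminorm σ (star a * a)) :=
      maxSeminorm_le fun p hp => Real.le_sqrt_of_sq_le <| by
        rw [sq, ← hp.2]; exact le_maxSeminorm hp _
    calc _ ≤ Real.sqrt (maxSeminorm σ (star a * a)) * Real.sqrt (maxSeminorm σ (star a * a)) :=
          mul_le_mul h h (apply_nonneg _ a) (Real.sqrt_nonneg _)
      _ = _ := Real.mul_self_sqrt (apply_nonneg _ _)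

instance : SeminormedAddCommGroup (TwistedGroupAlgebra σ) :=
  (maxSeminorm σ).toSeminormedAddCommGroup

theorem norm_def (a : TwistedGroupAlgebra σ) : ‖a‖ = maxSeminorm σ a := rfl

instance : SeminormedRing (TwistedGroupAlgebra σ) :=
  { (inferInstance : SeminormedAddCommGroup (TwistedGroupAlgebra σ)),
    (inferInstance : Ring (TwistedGroupAlgebra σ)) with
    norm_mul_le := maxSeminorm_mem.1 }

instance : NormedAlgebra ℂ (TwistedGroupAlgebra σ) where
  norm_smul_le c a := (map_smul_eq_mul (maxSeminorm σ) c a).le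

theorem norm_star_mul_self' (a : TwistedGroupAlgebra σ) : ‖star a * a‖ = ‖a‖ * ‖a‖ :=
  maxSeminorm_mem.2 a

instance : NormedStarGroup (TwistedGroupAlgebra σ) where
  norm_star_le a := by
    rcases (norm_nonneg (star a)).eq_or_lt with h | h
    · rw [← h]; exact norm_nonneg a
    · have h₁ := norm_star_mul_self' (star a)
      rw [star_star] at h₁
      have h₂ := norm_mul_le a (star a)
      nlinarith

end TwistedGroupAlgebra

/-- The (full) twisted group C*-algebra `C*(G, σ)` of the discrete group `G`: the completion of the
twisted group *-algebra for its largest C*-seminorm. -/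
def TwistedGroupCStar {G : Type*} [AddGroup G] (σ : Multiplier G) : Type _ :=
  UniformSpace.Completion (TwistedGroupAlgebra σ)

namespace TwistedGroupCStar

open UniformSpace TwistedGroupAlgebra

section

variable {G : Type*} [AddGroup G] {σ : Multiplier G}

instance : NormedRing (TwistedGroupCStar σ) :=
  inferInstanceAs (NormedRing (Completion (TwistedGroupAlgebra σ)))
instance : CompleteSpace (TwistedGroupCStar σ) :=
  inferInstanceAs (CompleteSpace (Completion (TwistedGroupAlgebra σ)))
instance : Algebra ℂ (TwistedGroupCStar σ) :=
  inferInstanceAs (Algebra ℂ (Completion (TwistedGroupAlgebra σ)))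
instance : NormedAlgebra ℂ (TwistedGroupCStar σ) where
  norm_smul_le c a := norm_smul_le (β := Completion (TwistedGroupAlgebra σ)) c a

/-- The canonical map from the twisted group *-algebra. -/
def ofAlg (a : TwistedGroupAlgebra σ) : TwistedGroupCStar σ := (a : Completion _)

theorem ofAlg_add (a b : TwistedGroupAlgebra σ) : ofAlg (a + b) = ofAlg a + ofAlg b :=
  Completion.coe_add a b
theorem ofAlg_mul (a b : TwistedGroupAlgebra σ) : ofAlg (a * b) = ofAlg a * ofAlg b :=
  Completion.coe_mul a b
theorem ofAlg_one : ofAlg (1 : TwistedGroupAlgebra σ) = 1 := rfl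
theorem ofAlg_zero : ofAlg (0 : TwistedGroupAlgebra σ) = 0 := rfl
theorem ofAlg_smul (c : ℂ) (a : TwistedGroupAlgebra σ) : ofAlg (c • a) = c • ofAlg a :=
  Completion.coe_smul c a
theorem norm_ofAlg (a : TwistedGroupAlgebra σ) : ‖ofAlg a‖ = ‖a‖ := Completion.norm_coe a
theorem continuous_ofAlg : Continuous (ofAlg (σ := σ)) := Completion.continuous_coe _
theorem denseRange_ofAlg : DenseRange (ofAlg (σ := σ)) := Completion.denseRange_coe

theorem uniformContinuous_star :
    UniformContinuous (star : TwistedGroupAlgebra σ → TwistedGroupAlgebra σ) := by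
  refine (LipschitzWith.of_dist_le_mul (K := 1) fun a b => ?_).uniformContinuous
  rw [dist_eq_norm, ← star_sub, norm_star, dist_eq_norm, NNReal.coe_one, one_mul]

instance : Star (TwistedGroupCStar σ) :=
  ⟨Completion.map (star : TwistedGroupAlgebra σ → TwistedGroupAlgebra σ)⟩

theorem ofAlg_star (a : TwistedGroupAlgebra σ) : ofAlg (star a) = star (ofAlg a) :=
  (Completion.map_coe uniformContinuous_star a).symm

theorem continuous_star' :
    Continuous (star : TwistedGroupCStar σ → TwistedGroupCStar σ) :=
  Completion.continuous_map

@[elab_as_elim]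
theorem induction_ofAlg {P : TwistedGroupCStar σ → Prop} (a : TwistedGroupCStar σ)
    (hc : IsClosed {a | P a}) (h : ∀ a, P (ofAlg a)) : P a :=
  Completion.induction_on a hc h

@[elab_as_elim]
theorem induction_ofAlg₂ {P : TwistedGroupCStar σ → TwistedGroupCStar σ → Prop}
    (a b : TwistedGroupCStar σ)
    (hc : IsClosed {q : TwistedGroupCStar σ × TwistedGroupCStar σ | P q.1 q.2})
    (h : ∀ a b, P (ofAlg a) (ofAlg b)) : P a b :=
  Completion.induction_on₂ a b hc h

instance : StarRing (TwistedGroupCStar σ) where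
  star_involutive a := by
    refine induction_ofAlg a
      (isClosed_eq (continuous_star'.comp continuous_star') continuous_id) fun a => ?_
    rw [← ofAlg_star, ← ofAlg_star, star_star]
  star_mul a b := by
    refine induction_ofAlg₂ a b (isClosed_eq (continuous_star'.comp (by fun_prop))
      ((continuous_star'.comp continuous_snd).mul (continuous_star'.comp continuous_fst)))
      fun a b => ?_
    rw [← ofAlg_mul, ← ofAlg_star, ← ofAlg_star, ← ofAlg_star, ← ofAlg_mul, star_mul]
  star_add a b := by
    refine induction_ofAlg₂ a b (isClosed_eq (continuous_star'.comp (by fun_prop))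
      ((continuous_star'.comp continuous_fst).add (continuous_star'.comp continuous_snd)))
      fun a b => ?_
    rw [← ofAlg_add, ← ofAlg_star, ← ofAlg_star, ← ofAlg_star, ← ofAlg_add, star_add]

instance : CStarAlgebra (TwistedGroupCStar σ) where
  norm_mul_self_le a := by
    refine induction_ofAlg a (isClosed_le (by fun_prop)
      (continuous_norm.comp (continuous_star'.mul continuous_id))) fun a => ?_
    rw [← ofAlg_star, ← ofAlg_mul, norm_ofAlg, norm_ofAlg, norm_star_mul_self']
  star_smul c a := by
    refine induction_ofAlg a (isClosed_eq (continuous_star'.comp (continuous_const_smul c))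
      (continuous_star'.const_smul (star c))) fun a => ?_
    rw [← ofAlg_smul, ← ofAlg_star, ← ofAlg_star, ← ofAlg_smul, star_smul]

variable (σ) in
/-- The canonical unitary `W x` of `C*(G, σ)`. -/
def W (x : G) : TwistedGroupCStar σ := ofAlg (δ x)

theorem W_mul (x y : G) : W σ x * W σ y = (σ x y : ℂ) • W σ (x + y) := by
  rw [W, W, W, ← ofAlg_mul, δ_mul_δ, ofAlg_smul]

theorem W_mem_unitary (x : G) : W σ x ∈ unitary (TwistedGroupCStar σ) := by
  rw [Unitary.mem_iff, W, ← ofAlg_star, ← ofAlg_mul, ← ofAlg_mul, star_δ_mul_self, δ_mul_star_self]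
  exact ⟨rfl, rfl⟩

theorem hom_ext {B : Type*} [CStarAlgebra B] {f g : TwistedGroupCStar σ →⋆ₐ[ℂ] B}
    (h : ∀ x, f (W σ x) = g (W σ x)) : f = g := by
  ext a
  refine induction_ofAlg a (isClosed_eq
    (AddMonoidHomClass.continuous_of_bound f 1 fun a => by
      simpa only [one_mul] using NonUnitalStarAlgHom.norm_apply_le f a)
    (AddMonoidHomClass.continuous_of_bound g 1 fun a => by
      simpa only [one_mul] using NonUnitalStarAlgHom.norm_apply_le g a)) fun a => ?_
  refine TwistedGroupAlgebra.induction_on a (by simp only [ofAlg_zero, map_zero])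
    (fun a b ha hb => by rw [ofAlg_add, map_add, map_add, ha, hb]) fun c x => ?_
  rw [ofAlg_smul, map_smul, map_smul]
  exact congrArg (c • ·) (h x)

/-- The *-homomorphism of the twisted group *-algebra attached to unitaries `u x` with
`u x * u y = σ x y • u (x + y)`. -/
def preLift {B : Type*} [CStarAlgebra B] (u : G → B) (hu : ∀ x, u x ∈ unitary B)
    (hmul : ∀ x y, u x * u y = (σ x y : ℂ) • u (x + y)) : TwistedGroupAlgebra σ →⋆ₐ[ℂ] B :=
  have h0 : u 0 = 1 := by
    have h := hmul 0 0
    rw [σ.zero_left, Circle.coe_one, one_smul, add_zero] at h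
    calc u 0 = star (u 0) * (u 0 * u 0) := by
          rw [← mul_assoc, Unitary.star_mul_self_of_mem (hu 0), one_mul]
      _ = 1 := by rw [h, Unitary.star_mul_self_of_mem (hu 0)]
  have hstar : ∀ x, starRingEnd ℂ (σ x (-x)) • u (-x) = star (u x) := fun x => by
    have h := hmul x (-x)
    rw [add_neg_cancel, h0] at h
    calc starRingEnd ℂ (σ x (-x)) • u (-x)
        = starRingEnd ℂ (σ x (-x)) • (star (u x) * (u x * u (-x))) := by
          rw [← mul_assoc, Unitary.star_mul_self_of_mem (hu x), one_mul]
      _ = star (u x) := by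
          rw [h, mul_smul_comm, smul_smul, mul_one, mul_comm, Complex.mul_conj, Circle.normSq_coe,
            Complex.ofReal_one, one_smul]
  { AlgHom.ofLinearMap (extend u) (by rw [one_def, extend_δ, h0]) (fun a b => by
      refine TwistedGroupAlgebra.induction_on a (by simp)
        (fun a a' h h' => by rw [add_mul, map_add, h, h', map_add, add_mul]) fun c x => ?_
      refine TwistedGroupAlgebra.induction_on b (by simp)
        (fun b b' h h' => by rw [mul_add, map_add, h, h', map_add, mul_add]) fun d y => ?_
      rw [smul_mul_smul_comm, δ_mul_δ]
      simp only [map_smul, extend_δ, smul_mul_smul_comm, hmul]) with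
    map_star' := fun a => by
      refine TwistedGroupAlgebra.induction_on (P := fun a => extend u (star a) = star (extend u a))
        a (by simp) (fun a a' h h' => by rw [star_add, map_add, h, h', map_add, star_add])
        fun c x => ?_
      rw [star_smul_δ, map_smul, map_smul, extend_δ, extend_δ, star_smul, ← hstar x, smul_smul,
        map_mul]
      rfl }

theorem preLift_δ {B : Type*} [CStarAlgebra B] (u : G → B) (hu : ∀ x, u x ∈ unitary B)
    (hmul : ∀ x y, u x * u y = (σ x y : ℂ) • u (x + y)) (x : G) :
    preLift u hu hmul (δ x) = u x :=
  extend_δ u x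

theorem norm_starAlgHom_le {B : Type*} [CStarAlgebra B] (f : TwistedGroupAlgebra σ →⋆ₐ[ℂ] B)
    (a : TwistedGroupAlgebra σ) : ‖f a‖ ≤ ‖a‖ := by
  refine le_maxSeminorm (p := (normSeminorm ℂ B).comp (f : TwistedGroupAlgebra σ →ₗ[ℂ] B))
    ⟨fun a b => ?_, fun a => ?_⟩ a
  · change ‖f (a * b)‖ ≤ ‖f a‖ * ‖f b‖
    rw [map_mul]; exact norm_mul_le _ _
  · change ‖f (star a * a)‖ = ‖f a‖ * ‖f a‖
    rw [map_mul, map_star, CStarRing.norm_star_mul_self]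

/-- The universal property of `C*(G, σ)`: unitaries `u x` of a C*-algebra `B` with
`u x * u y = σ x y • u (x + y)` extend to a *-homomorphism `C*(G, σ) → B` with `W x ↦ u x`. -/
def lift {B : Type*} [CStarAlgebra B] (u : G → B) (hu : ∀ x, u x ∈ unitary B)
    (hmul : ∀ x y, u x * u y = (σ x y : ℂ) • u (x + y)) : TwistedGroupCStar σ →⋆ₐ[ℂ] B :=
  let f := preLift u hu hmul
  have hf : UniformContinuous f := by
    refine (LipschitzWith.of_dist_le_mul (K := 1) fun a b => ?_).uniformContinuous
    rw [dist_eq_norm, ← map_sub, dist_eq_norm, NNReal.coe_one, one_mul]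
    exact norm_starAlgHom_le f _
  let F : TwistedGroupCStar σ → B := Completion.extension f
  have hF : Continuous F := Completion.continuous_extension
  have hFf : ∀ a, F (ofAlg a) = f a := fun a => Completion.extension_coe hf a
  { toFun := F
    map_one' := by rw [← ofAlg_one, hFf, map_one]
    map_zero' := by rw [← ofAlg_zero, hFf, map_zero]
    map_mul' := fun a b => by
      refine induction_ofAlg₂ a b (isClosed_eq (hF.comp (by fun_prop))
        ((hF.comp continuous_fst).mul (hF.comp continuous_snd))) fun a b => ?_
      rw [← ofAlg_mul, hFf, hFf, hFf, map_mul]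
    map_add' := fun a b => by
      refine induction_ofAlg₂ a b (isClosed_eq (hF.comp (by fun_prop))
        ((hF.comp continuous_fst).add (hF.comp continuous_snd))) fun a b => ?_
      rw [← ofAlg_add, hFf, hFf, hFf, map_add]
    commutes' := fun c => by
      rw [Algebra.algebraMap_eq_smul_one, Algebra.algebraMap_eq_smul_one, ← ofAlg_one,
        ← ofAlg_smul, hFf, map_smul, map_one]
    map_star' := fun a => by
      refine induction_ofAlg a (isClosed_eq (hF.comp continuous_star)
        (continuous_star.comp hF)) fun a => ?_
      rw [← ofAlg_star, hFf, hFf, map_star] }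

@[simp] theorem lift_W {B : Type*} [CStarAlgebra B] (u : G → B) (hu : ∀ x, u x ∈ unitary B)
    (hmul : ∀ x y, u x * u y = (σ x y : ℂ) • u (x + y)) (x : G) :
    lift u hu hmul (W σ x) = u x := by
  refine (Completion.extension_coe (f := preLift u hu hmul) ?_ (δ x)).trans (preLift_δ u hu hmul x)
  refine (LipschitzWith.of_dist_le_mul (K := 1) fun a b => ?_).uniformContinuous
  rw [dist_eq_norm, ← map_sub, dist_eq_norm, NNReal.coe_one, one_mul]
  exact norm_starAlgHom_le _ _

theorem circle_smul_mem_unitary {B : Type*} [CStarAlgebra B] (z : Circle) {u : B}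
    (hu : u ∈ unitary B) : (z : ℂ) • u ∈ unitary B := by
  have hz : starRingEnd ℂ (z : ℂ) * (z : ℂ) = 1 := by
    rw [mul_comm, Complex.mul_conj, Circle.normSq_coe, Complex.ofReal_one]
  rw [Unitary.mem_iff] at hu ⊢
  rw [star_smul, smul_mul_smul_comm, smul_mul_smul_comm, hu.1, hu.2]
  constructor
  · exact (congrArg (· • (1 : B)) hz).trans (one_smul _ _)
  · exact (congrArg (· • (1 : B)) ((mul_comm _ _).trans hz)).trans (one_smul _ _)

/-- The *-endomorphism `W x ↦ χ x • W x` attached to a character `χ` of `G`. -/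
def dualHom (χ : AddChar G Circle) : TwistedGroupCStar σ →⋆ₐ[ℂ] TwistedGroupCStar σ :=
  lift (fun x => (χ x : ℂ) • W σ x) (fun x => circle_smul_mem_unitary (χ x) (W_mem_unitary x))
    fun x y => by
      rw [smul_mul_smul_comm, W_mul, smul_smul, smul_smul, AddChar.map_add_eq_mul, Circle.coe_mul,
        mul_comm]

theorem dualHom_W (χ : AddChar G Circle) (x : G) :
    dualHom χ (W σ x) = (χ x : ℂ) • W σ x :=
  lift_W _ _ _ x

end

section

variable {G : Type*} [AddCommGroup G] (σ : Multiplier G)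

theorem dualHom_dualHom (χ ψ : AddChar G Circle) (a : TwistedGroupCStar σ) :
    dualHom χ (dualHom ψ a) = dualHom (χ * ψ) a := by
  have h : (dualHom χ).comp (dualHom ψ) = dualHom (σ := σ) (χ * ψ) := hom_ext fun x => by
    rw [StarAlgHom.comp_apply, dualHom_W, dualHom_W, map_smul, dualHom_W, smul_smul,
      AddChar.mul_apply, Circle.coe_mul, mul_comm]
  rw [← h, StarAlgHom.comp_apply]

theorem dualHom_one (a : TwistedGroupCStar σ) : dualHom 1 a = a := by
  have h : dualHom 1 = StarAlgHom.id ℂ (TwistedGroupCStar σ) := hom_ext fun x => by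
    rw [dualHom_W, AddChar.one_apply, Circle.coe_one, one_smul]
    rfl
  rw [h]
  rfl

/-- The dual action of the character group of `G` on `C*(G, σ)` by *-automorphisms, determined by
`χ · W x = χ x • W x`. -/
def dualAction : AddChar G Circle →* (TwistedGroupCStar σ ≃⋆ₐ[ℂ] TwistedGroupCStar σ) where
  toFun χ := StarAlgEquiv.ofStarAlgHom (dualHom χ) (dualHom χ⁻¹)
    (by ext a; simp [dualHom_dualHom, dualHom_one]) (by ext a; simp [dualHom_dualHom, dualHom_one])
  map_one' := by ext a; exact dualHom_one σ a
  map_mul' χ ψ := by ext a; exact (dualHom_dualHom σ χ ψ a).symm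

theorem dualAction_W (χ : AddChar G Circle) (x : G) :
    dualAction σ χ (W σ x) = (χ x : ℂ) • W σ x :=
  dualHom_W χ x

end

end TwistedGroupCStar

/-! ### Tracial states and simplicity -/

open scoped ComplexOrder in
/-- A tracial state on a unital C*-algebra: a positive linear functional `τ` with `τ 1 = 1`
(equivalently, of norm one) and `τ (a * b) = τ (b * a)`. -/
structure TracialState (A : Type*) [CStarAlgebra A] extends A →L[ℂ] ℂ where
  nonneg' : ∀ a, 0 ≤ toFun (star a * a)
  map_one' : toFun 1 = 1
  trace' : ∀ a b, toFun (a * b) = toFun (b * a)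

instance {A : Type*} [CStarAlgebra A] : CoeFun (TracialState A) (fun _ => A → ℂ) :=
  ⟨fun τ => τ.toContinuousLinearMap⟩

/-- A C*-algebra is simple if it is nonzero and its only closed two-sided ideals are trivial. -/
def IsSimpleCStar (A : Type*) [CStarAlgebra A] : Prop :=
  Nontrivial A ∧ ∀ I : TwoSidedIdeal A, IsClosed (I : Set A) → I = ⊥ ∨ I = ⊤

/-! ### Noncommutative solenoids -/

/-- The group `ℚ_N` of `N`-adic rationals, as a subring of `ℚ` (only its additive group is used,
together with products to write the multipliers). -/
def NadicRat (N : ℕ) [Fact (1 < N)] : Subring ℚ where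
  carrier := {x | ∃ (p : ℤ) (k : ℕ), x = p / (N : ℚ) ^ k}
  zero_mem' := ⟨0, 0, by simp⟩
  one_mem' := ⟨1, 0, by simp⟩
  add_mem' := by
    have hN : (N : ℚ) ≠ 0 := Nat.cast_ne_zero.2 (zero_lt_one.trans (Fact.out : 1 < N)).ne'
    rintro _ _ ⟨p, k, rfl⟩ ⟨q, l, rfl⟩
    refine ⟨p * N ^ l + N ^ k * q, k + l, ?_⟩
    rw [div_add_div _ _ (pow_ne_zero k hN) (pow_ne_zero l hN), pow_add]
    push_cast
    rfl
  mul_mem' := by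
    rintro _ _ ⟨p, k, rfl⟩ ⟨q, l, rfl⟩
    exact ⟨p * q, k + l, by push_cast; rw [div_mul_div_comm, pow_add]⟩
  neg_mem' := by
    rintro _ ⟨p, k, rfl⟩
    exact ⟨-p, k, by push_cast; rw [neg_div]⟩

/-- The element `p / N ^ k` of `ℚ_N`. -/
def NadicRat.mk {N : ℕ} [Fact (1 < N)] (p : ℤ) (k : ℕ) : NadicRat N :=
  ⟨p / (N : ℚ) ^ k, p, k, rfl⟩

theorem NadicRat.exists_mk {N : ℕ} [Fact (1 < N)] (x : NadicRat N) :
    ∃ (p : ℤ) (k : ℕ), x = NadicRat.mk p k := by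
  obtain ⟨x, p, k, h⟩ := x
  exact ⟨p, k, Subtype.ext h⟩

theorem NadicRat.mk_mul_mk {N : ℕ} [Fact (1 < N)] (p q : ℤ) (k l : ℕ) :
    (NadicRat.mk p k * NadicRat.mk q l : NadicRat N) = NadicRat.mk (p * q) (k + l) := by
  apply Subtype.ext
  simp only [NadicRat.mk, Subring.coe_mul]
  push_cast
  rw [div_mul_div_comm, pow_add]

theorem NadicRat.mk_eq_mk_iff {N : ℕ} [Fact (1 < N)] (p q : ℤ) (k l : ℕ) :
    (NadicRat.mk p k : NadicRat N) = NadicRat.mk q l ↔ p * (N : ℤ) ^ l = q * (N : ℤ) ^ k := by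
  have hN : (N : ℚ) ≠ 0 := Nat.cast_ne_zero.2 (zero_lt_one.trans (Fact.out : 1 < N)).ne'
  rw [← Subtype.val_inj]
  change (p : ℚ) / (N : ℚ) ^ k = (q : ℚ) / (N : ℚ) ^ l ↔ _
  rw [div_eq_div_iff (pow_ne_zero k hN)
    (pow_ne_zero l hN)]
  exact_mod_cast Iff.rfl

/-- The solenoid group `𝒮_N`. -/
def Solenoid (N : ℕ) : Subgroup (ℕ → Circle) where
  carrier := {z | ∀ n, z (n + 1) ^ N = z n}
  one_mem' := fun n => by simp
  mul_mem' := fun {z w} hz hw n => by simp [mul_pow, hz n, hw n]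
  inv_mem' := fun {z} hz n => by simp [hz n]

namespace Solenoid

variable {N : ℕ}

theorem pow_pow (z : Solenoid N) (k m : ℕ) : z.1 (k + m) ^ N ^ m = z.1 k := by
  induction m with
  | zero => simp
  | succ m ih => rw [pow_succ', pow_mul, ← add_assoc, z.2, ih]

variable [Fact (1 < N)]

theorem zpow_eq (z : Solenoid N) {p q : ℤ} {k l : ℕ}
    (h : (NadicRat.mk p k : NadicRat N) = NadicRat.mk q l) : z.1 k ^ p = z.1 l ^ q := by
  rw [NadicRat.mk_eq_mk_iff] at h
  rw [← pow_pow z k l, ← pow_pow z l k, add_comm l k, ← zpow_natCast, ← zpow_natCast, ← zpow_mul,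
    ← zpow_mul, Nat.cast_pow, Nat.cast_pow, mul_comm _ p, mul_comm _ q, h]

/-- The value of the dual pairing, `⟨p / N ^ k, z⟩ = z k ^ p`; see `pairing_mk`. -/
def pairingFun (z : Solenoid N) (x : NadicRat N) : Circle :=
  z.1 (NadicRat.exists_mk x).choose_spec.choose ^ (NadicRat.exists_mk x).choose

theorem pairingFun_mk (z : Solenoid N) (p : ℤ) (k : ℕ) :
    pairingFun z (NadicRat.mk p k) = z.1 k ^ p :=
  zpow_eq z (NadicRat.exists_mk (NadicRat.mk p k : NadicRat N)).choose_spec.choose_spec.symm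

/-- The dual pairing between `𝒮_N` and `ℚ_N`, given by `⟨p / N ^ k, z⟩ = z k ^ p`. -/
def pairing (z : Solenoid N) : AddChar (NadicRat N) Circle where
  toFun := pairingFun z
  map_zero_eq_one' := by
    have h : (0 : NadicRat N) = NadicRat.mk 0 0 := Subtype.ext (by simp [NadicRat.mk])
    rw [h, pairingFun_mk, zpow_zero]
  map_add_eq_mul' x y := by
    have hN : (N : ℚ) ≠ 0 := Nat.cast_ne_zero.2 (zero_lt_one.trans (Fact.out : 1 < N)).ne'
    obtain ⟨p, k, rfl⟩ := NadicRat.exists_mk x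
    obtain ⟨q, l, rfl⟩ := NadicRat.exists_mk y
    have h : (NadicRat.mk p k + NadicRat.mk q l : NadicRat N) =
        NadicRat.mk (p * N ^ l + N ^ k * q) (k + l) := by
      apply Subtype.ext
      simp only [NadicRat.mk, Subring.coe_add]
      rw [div_add_div _ _ (pow_ne_zero k hN) (pow_ne_zero l hN), pow_add]
      push_cast
      rfl
    have hp : (NadicRat.mk p k : NadicRat N) = NadicRat.mk (p * N ^ l) (k + l) := by
      rw [NadicRat.mk_eq_mk_iff]; ring
    have hq : (NadicRat.mk q l : NadicRat N) = NadicRat.mk (N ^ k * q) (k + l) := by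
      rw [NadicRat.mk_eq_mk_iff]; ring
    rw [h, hp, hq, pairingFun_mk, pairingFun_mk, pairingFun_mk, zpow_add]

theorem pairing_mk (z : Solenoid N) (p : ℤ) (k : ℕ) :
    pairing z (NadicRat.mk p k) = z.1 k ^ p :=
  pairingFun_mk z p k

/-- The pairing of `𝒮_N × 𝒮_N` with `ℚ_N × ℚ_N`: `(z, w)` acts as `(x, y) ↦ ⟨x, z⟩ ⟨y, w⟩`. -/
def pairing₂ (s : Solenoid N × Solenoid N) : AddChar (NadicRat N × NadicRat N) Circle where
  toFun g := pairing s.1 g.1 * pairing s.2 g.2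
  map_zero_eq_one' := by simp
  map_add_eq_mul' g h := by
    simp only [Prod.fst_add, Prod.snd_add, AddChar.map_add_eq_mul]
    exact mul_mul_mul_comm _ _ _ _

theorem pairing₂_apply (s : Solenoid N × Solenoid N) (x y : NadicRat N) :
    pairing₂ s (x, y) = pairing s.1 x * pairing s.2 y := rfl

end Solenoid

/-- The set `Ξ_N` of parameters. -/
def Xi (N : ℕ) : Set (ℕ → ℝ) :=
  {ν | ν 0 ∈ Set.Ico (0 : ℝ) 1 ∧ ∀ n, ∃ k ∈ Finset.range N, N * ν (n + 1) = ν n + k}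

namespace Xi

variable {N : ℕ} [Fact (1 < N)]

/-- The point `(exp (2πi α_n))_n` of the solenoid attached to `α ∈ Ξ_N`. -/
def toSolenoid (α : Xi N) : Solenoid N :=
  ⟨fun n => Circle.exp (2 * Real.pi * α.1 n), fun n => by
    obtain ⟨k, -, hk⟩ := α.2.2 n
    rw [← Circle.exp_natCast_mul, mul_left_comm, hk, mul_add, mul_comm _ (k : ℝ),
      Circle.exp_add, Circle.exp_natCast_mul, Circle.exp_two_pi, one_pow, mul_one]⟩

/-- The multiplier `Ψ_α` of `ℚ_N × ℚ_N`, given by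
`Ψ_α ((p₁/N^k₁, p₂/N^k₂), (p₃/N^k₃, p₄/N^k₄)) = exp (2πi α_(k₁+k₄) p₁ p₄)`; see `Psi_mk`. -/
def Psi (α : Xi N) : Multiplier (NadicRat N × NadicRat N) where
  toFun g h := Solenoid.pairing (toSolenoid α) (g.1 * h.2)
  zero_left h := by simp
  zero_right g := by simp
  cocycle x y z := by
    simp only [Prod.fst_add, Prod.snd_add, add_mul, mul_add, AddChar.map_add_eq_mul]
    rw [mul_assoc]

theorem Psi_mk (α : Xi N) (p₁ p₂ p₃ p₄ : ℤ) (k₁ k₂ k₃ k₄ : ℕ) :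
    (Psi α (NadicRat.mk p₁ k₁, NadicRat.mk p₂ k₂) (NadicRat.mk p₃ k₃, NadicRat.mk p₄ k₄) : ℂ) =
      Complex.exp (2 * Real.pi * Complex.I * (α.1 (k₁ + k₄) * p₁ * p₄)) := by
  change ((Solenoid.pairing (toSolenoid α) (NadicRat.mk p₁ k₁ * NadicRat.mk p₄ k₄) : Circle) : ℂ) = _
  rw [NadicRat.mk_mul_mk, Solenoid.pairing_mk, toSolenoid, Circle.coe_zpow, Circle.coe_exp,
    ← Complex.exp_int_mul]
  congr 1
  push_cast
  ring

end Xi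

/-- The noncommutative solenoid `C*(ℚ_N × ℚ_N, Ψ_α)`. -/
abbrev NCSolenoid (N : ℕ) [Fact (1 < N)] (α : Xi N) : Type :=
  TwistedGroupCStar (Xi.Psi α)

/-- The dual action of `𝒮_N × 𝒮_N` on the noncommutative solenoid:
`(z, w) · W (x, y) = ⟨x, z⟩ ⟨y, w⟩ • W (x, y)`. -/
def NCSolenoid.dualAction (N : ℕ) [Fact (1 < N)] (α : Xi N) :
    Solenoid N × Solenoid N →* (NCSolenoid N α ≃⋆ₐ[ℂ] NCSolenoid N α) :=
  (TwistedGroupCStar.dualAction (Xi.Psi α)).comp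
    { toFun := Solenoid.pairing₂
      map_one' := by
        ext g
        obtain ⟨x, y⟩ := g
        obtain ⟨p, k, rfl⟩ := NadicRat.exists_mk x
        obtain ⟨q, l, rfl⟩ := NadicRat.exists_mk y
        simp [Solenoid.pairing₂_apply, Solenoid.pairing_mk]
      map_mul' := fun s t => by
        ext g
        obtain ⟨x, y⟩ := g
        obtain ⟨p, k, rfl⟩ := NadicRat.exists_mk x
        obtain ⟨q, l, rfl⟩ := NadicRat.exists_mk y
        simp [Solenoid.pairing₂_apply, Solenoid.pairing_mk, mul_zpow]
        ring }

theorem NCSolenoid.dualAction_W (N : ℕ) [Fact (1 < N)] (α : Xi N) (z w : Solenoid N)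
    (x y : NadicRat N) :
    NCSolenoid.dualAction N α (z, w) (TwistedGroupCStar.W (Xi.Psi α) (x, y)) =
      ((Solenoid.pairing z x * Solenoid.pairing w y : Circle) : ℂ) • TwistedGroupCStar.W (Xi.Psi α) (x, y) :=
  TwistedGroupCStar.dualAction_W (Xi.Psi α) (Solenoid.pairing₂ (z, w)) (x, y)

end

/-! ### Central elements of simple C*-algebras -/

/-! Nothing beyond a multiplier `σ` on a discrete abelian group `G` matters here. The left regular
representation on `ℓ²(G)` sends `W x` to translation by `x` twisted by a phase, so its vector state
at the basis vector of `0` is 1 at `W 0 = 1` and 0 at every other `W x`. It is a trace because `W x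
* W y` and `W y * W x` are both sent to 0 unless `y = -x`, and `σ x (-x) = σ (-x) x`. It is
invariant because the dual action only rescales each `W x`, and fixes `W 0`.

For uniqueness, conjugation by `W y` multiplies `W x` by a ratio of `σ x y` and `σ y x`. If these
differ for some `y`, every trace vanishes at `W x` (`trace_W_eq_zero_of_ne`). If they agree for all
`y`, then `W x` is central, hence scalar when the algebra is simple
(`IsSimpleCStar.exists_eq_algebraMap_of_central`). For `x ≠ 0` the canonical trace shows that the
scalar is 0, which is absurd for a unitary (`IsSimpleCStar.exists_multiplier_ne`). So under
simplicity every tracial state agrees with the canonical one on all `W x`, whose span is dense. -/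

/-- The closure of the ideal generated by a central element. -/
def closedIdealOfCentral {A : Type*} [NormedRing A] (z : A) (hz : ∀ a, Commute z a) :
    TwoSidedIdeal A :=
  .mk' (closure (Set.range (z * ·)))
    (subset_closure ⟨0, mul_zero z⟩)
    (fun hx hy => map_mem_closure₂ continuous_add hx hy (by
      rintro _ ⟨a, rfl⟩ _ ⟨b, rfl⟩
      exact ⟨a + b, mul_add z a b⟩))
    (fun hx => map_mem_closure continuous_neg hx (by
      rintro _ ⟨a, rfl⟩
      exact ⟨-a, mul_neg z a⟩))
    -- The only absorption that uses centrality: `x * (z * a) = z * (x * a)`.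
    (fun {x _} hy => map_mem_closure (continuous_const_mul x) hy (by
      rintro _ ⟨a, rfl⟩
      exact ⟨x * a, by simp only [← mul_assoc, (hz x).eq]⟩))
    (fun {x y} hx => map_mem_closure (f := (· * y)) (continuous_mul_const y) hx (by
      rintro _ ⟨a, rfl⟩
      exact ⟨a * y, (mul_assoc z a y).symm⟩))

theorem coe_closedIdealOfCentral {A : Type*} [NormedRing A] (z : A) (hz : ∀ a, Commute z a) :
    (closedIdealOfCentral z hz : Set A) = closure (Set.range (z * ·)) :=
  TwoSidedIdeal.coe_mk' _ _ _ _ _ _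

/-- Some multiple `z * b` lies within distance 1 of the identity, so it is invertible by the Neumann
series; commuting factors of a unit are units. -/
theorem isUnit_of_closedIdealOfCentral_eq_top {A : Type*} [NormedRing A] [CompleteSpace A]
    (z : A) (hz : ∀ a, Commute z a) (h : closedIdealOfCentral z hz = ⊤) : IsUnit z := by
  have h₁ : (1 : A) ∈ closure (Set.range (z * ·)) := by
    rw [← coe_closedIdealOfCentral z hz, h]
    exact TwoSidedIdeal.mem_top A
  obtain ⟨_, ⟨b, rfl⟩, hb⟩ := Metric.mem_closure_iff.1 h₁ 1 one_pos
  rw [dist_eq_norm] at hb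
  have hu : IsUnit (z * b) := by
    simpa using (Units.oneSub _ hb).isUnit
  exact ((hz b).isUnit_mul_iff.1 hu).1

/-- For `c` in the spectrum of `z`, the element `c - z` is central and not invertible, so its closed
ideal is proper. Simplicity makes that ideal zero. -/
theorem IsSimpleCStar.exists_eq_algebraMap_of_central {A : Type*} [CStarAlgebra A]
    (h : IsSimpleCStar A) (z : A) (hz : ∀ a, Commute z a) : ∃ c : ℂ, z = algebraMap ℂ A c := by
  have := h.1
  obtain ⟨c, hc⟩ := spectrum.nonempty z
  have hw : ∀ a, Commute (algebraMap ℂ A c - z) a := fun a =>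
    Commute.sub_left (Algebra.commutes c a) (hz a)
  refine ⟨c, ?_⟩
  rcases h.2 (closedIdealOfCentral _ hw)
    (by rw [coe_closedIdealOfCentral]; exact isClosed_closure) with hI | hI
  · have hmem : algebraMap ℂ A c - z ∈ (closedIdealOfCentral _ hw : Set A) := by
      rw [coe_closedIdealOfCentral]
      exact subset_closure ⟨1, mul_one _⟩
    rw [hI] at hmem
    exact (sub_eq_zero.1 ((TwoSidedIdeal.mem_bot A).1 hmem)).symm
  · exact absurd (isUnit_of_closedIdealOfCentral_eq_top _ hw hI) hc

/-! ### The left regular representation of a twisted group C*-algebra -/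

namespace TwistedGroupCStar

open TwistedGroupAlgebra
open scoped lp InnerProductSpace ComplexOrder

section

variable {G : Type*} [AddGroup G] (σ : Multiplier G)

/-- The standard Hilbert basis of `ℓ²(G)`. -/
noncomputable def stdBasis (G : Type*) : HilbertBasis G ℂ ℓ²(G, ℂ) := ⟨LinearIsometryEquiv.refl ℂ _⟩

theorem orthonormal_translate (x : G) :
    Orthonormal ℂ fun y => (σ x y : ℂ) • stdBasis G (x + y) := by
  have h := (stdBasis G).orthonormal
  refine ⟨fun y => by rw [norm_smul, Circle.norm_coe, h.1, one_mul], fun y z hyz => ?_⟩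
  simp only [inner_smul_left, inner_smul_right]
  rw [h.2 fun e => hyz (add_left_cancel e), mul_zero, mul_zero]

/-- Together with orthonormality this makes the translated family a Hilbert basis. Twisted
translation is then a change of Hilbert basis, hence automatically unitary. -/
theorem span_translate (x : G) :
    Submodule.span ℂ (Set.range fun y => (σ x y : ℂ) • stdBasis G (x + y)) =
      Submodule.span ℂ (Set.range (stdBasis G)) := by
  refine le_antisymm (Submodule.span_le.2 ?_) (Submodule.span_le.2 ?_)
  · rintro _ ⟨y, rfl⟩
    exact Submodule.smul_mem _ _ (Submodule.subset_span ⟨x + y, rfl⟩)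
  · rintro _ ⟨y, rfl⟩
    -- The vector at `y` is the translate of the one at `-x + y`, up to an invertible phase.
    have h := Submodule.smul_mem _ (σ x (-x + y) : ℂ)⁻¹
      (Submodule.subset_span (R := ℂ)
        (Set.mem_range_self (f := fun y => (σ x y : ℂ) • stdBasis G (x + y)) (-x + y)))
    rwa [smul_smul, inv_mul_cancel₀ (Circle.coe_ne_zero _), one_smul, add_neg_cancel_left] at h

/-- The Hilbert basis of `ℓ²(G)` obtained from the standard one by a twisted left translation. -/
noncomputable def translateBasis (x : G) : HilbertBasis G ℂ ℓ²(G, ℂ) :=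
  .mk (orthonormal_translate σ x) (by rw [span_translate, (stdBasis G).dense_span])

/-- Twisted left translation, as a unitary operator on `ℓ²(G)`. -/
noncomputable def regularUnitary (x : G) : unitary (ℓ²(G, ℂ) →L[ℂ] ℓ²(G, ℂ)) :=
  Unitary.linearIsometryEquiv.symm ((stdBasis G).repr.trans (translateBasis σ x).repr.symm)

theorem regularUnitary_stdBasis (x y : G) :
    (regularUnitary σ x : ℓ²(G, ℂ) →L[ℂ] ℓ²(G, ℂ)) (stdBasis G y) =
      (σ x y : ℂ) • stdBasis G (x + y) := by
  classical
  change (translateBasis σ x).repr.symm ((stdBasis G).repr (stdBasis G y)) = _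
  rw [HilbertBasis.repr_self, HilbertBasis.repr_symm_single, translateBasis, HilbertBasis.coe_mk]

theorem regularUnitary_mul (x y : G) :
    (regularUnitary σ x * regularUnitary σ y : ℓ²(G, ℂ) →L[ℂ] ℓ²(G, ℂ)) =
      (σ x y : ℂ) • (regularUnitary σ (x + y) : ℓ²(G, ℂ) →L[ℂ] ℓ²(G, ℂ)) := by
  refine ContinuousLinearMap.ext_on
    (Submodule.dense_iff_topologicalClosure_eq_top.2 (stdBasis G).dense_span) ?_
  rintro _ ⟨z, rfl⟩
  rw [mul_apply_eq_comp, smul_apply, regularUnitary_stdBasis,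
    map_smul, regularUnitary_stdBasis, regularUnitary_stdBasis, smul_smul, smul_smul, add_assoc]
  -- Both sides now sit at the basis vector of `x + (y + z)`; equality of the phases is the cocycle
  -- identity.
  congr 1
  have h := congrArg (fun u : Circle => (u : ℂ)) (σ.cocycle x y z)
  simp only [Circle.coe_mul] at h
  rw [h, mul_comm]

/-- The left regular representation of `C*(G, σ)` on `ℓ²(G)`. -/
noncomputable def regularRep : TwistedGroupCStar σ →⋆ₐ[ℂ] (ℓ²(G, ℂ) →L[ℂ] ℓ²(G, ℂ)) :=
  lift (fun x => (regularUnitary σ x : ℓ²(G, ℂ) →L[ℂ] ℓ²(G, ℂ)))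
    (fun x => (regularUnitary σ x).2) (regularUnitary_mul σ)

theorem regularRep_W_stdBasis (x y : G) :
    regularRep σ (W σ x) (stdBasis G y) = (σ x y : ℂ) • stdBasis G (x + y) := by
  rw [regularRep, lift_W, regularUnitary_stdBasis]

theorem continuous_regularRep : Continuous (regularRep σ) :=
  AddMonoidHomClass.continuous_of_bound (regularRep σ) 1 fun a => by
    simpa only [one_mul] using NonUnitalStarAlgHom.norm_apply_le (regularRep σ) a

/-! ### The canonical trace as a vector state -/

/-- The vector functional of the left regular representation at the basis vector of `0`. -/
noncomputable def canonicalFunctional : TwistedGroupCStar σ →L[ℂ] ℂ where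
  toFun a := ⟪stdBasis G 0, regularRep σ a (stdBasis G 0)⟫_ℂ
  map_add' a b := by rw [map_add, add_apply, inner_add_right]
  map_smul' c a := by
    rw [map_smul, smul_apply, inner_smul_right, RingHom.id_apply, smul_eq_mul]
  cont := by
    have := continuous_regularRep σ
    fun_prop

theorem canonicalFunctional_apply (a : TwistedGroupCStar σ) :
    canonicalFunctional σ a = ⟪stdBasis G 0, regularRep σ a (stdBasis G 0)⟫_ℂ := rfl

theorem canonicalFunctional_W_zero : canonicalFunctional σ (W σ 0) = 1 := by
  rw [canonicalFunctional_apply, regularRep_W_stdBasis, σ.zero_left, add_zero, Circle.coe_one,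
    one_smul, inner_self_eq_norm_sq_to_K, (stdBasis G).orthonormal.1]
  simp

theorem canonicalFunctional_W_of_ne_zero {x : G} (hx : x ≠ 0) :
    canonicalFunctional σ (W σ x) = 0 := by
  rw [canonicalFunctional_apply, regularRep_W_stdBasis, add_zero, inner_smul_right,
    (stdBasis G).orthonormal.2 hx.symm, mul_zero]

variable {σ}

-- The `W x` span a dense subspace, so identities between continuous linear expressions need
-- checking only there.
@[elab_as_elim]
theorem induction_W {P : TwistedGroupCStar σ → Prop} (a : TwistedGroupCStar σ)
    (closed : IsClosed {a | P a}) (zero : P 0) (sum : ∀ a b, P a → P b → P (a + b))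
    (smul : ∀ (c : ℂ) a, P a → P (c • a)) (W : ∀ x, P (W σ x)) : P a :=
  induction_ofAlg a closed fun a => TwistedGroupAlgebra.induction_on a zero
    (fun a b ha hb => by rw [ofAlg_add]; exact sum _ _ ha hb)
    (fun c x => by rw [ofAlg_smul]; exact smul c _ (W x))

theorem functional_ext {f g : TwistedGroupCStar σ →L[ℂ] ℂ}
    (h : ∀ x, f (W σ x) = g (W σ x)) : f = g := by
  ext a
  exact induction_W a (isClosed_eq f.continuous g.continuous) (by simp only [map_zero])
    (fun a b ha hb => by rw [map_add, map_add, ha, hb])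
    (fun c a ha => by rw [map_smul, map_smul, ha]) h

theorem W_zero : W σ 0 = 1 := rfl

variable (σ)

theorem canonicalFunctional_W_mul_comm (x y : G) :
    canonicalFunctional σ (W σ x * W σ y) = canonicalFunctional σ (W σ y * W σ x) := by
  rw [W_mul, W_mul, map_smul, map_smul]
  by_cases h : x + y = 0
  · obtain rfl := eq_neg_of_add_eq_zero_right h
    rw [add_neg_cancel, neg_add_cancel, multiplier_neg]
  -- `G` need not be abelian here: `x + y` and `y + x` still vanish together.
  · have h' : y + x ≠ 0 := fun e => h (by
      rw [eq_neg_of_add_eq_zero_right e, neg_add_cancel])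
    rw [canonicalFunctional_W_of_ne_zero σ h, canonicalFunctional_W_of_ne_zero σ h', smul_zero,
      smul_zero]

theorem canonicalFunctional_mul_comm (a b : TwistedGroupCStar σ) :
    canonicalFunctional σ (a * b) = canonicalFunctional σ (b * a) := by
  refine induction_W a (isClosed_eq (by fun_prop) (by fun_prop)) (by rw [zero_mul, mul_zero])
    (fun a a' h h' => by rw [add_mul, mul_add, map_add, map_add, h, h'])
    (fun c a h => by rw [smul_mul_assoc, mul_smul_comm, map_smul, map_smul, h]) fun x => ?_
  refine induction_W b (isClosed_eq (by fun_prop) (by fun_prop)) (by rw [zero_mul, mul_zero])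
    (fun b b' h h' => by rw [add_mul, mul_add, map_add, map_add, h, h'])
    (fun c b h => by rw [smul_mul_assoc, mul_smul_comm, map_smul, map_smul, h]) fun y => ?_
  exact canonicalFunctional_W_mul_comm σ x y

/-- The canonical tracial state of `C*(G, σ)`, which vanishes on `W x` for `x ≠ 0`. -/
noncomputable def canonicalTrace : TracialState (TwistedGroupCStar σ) where
  toContinuousLinearMap := canonicalFunctional σ
  nonneg' a := by
    change 0 ≤ canonicalFunctional σ (star a * a)
    -- Moving the adjoint across the inner product gives `‖regularRep σ a (stdBasis G 0)‖ ^ 2`.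
    rw [canonicalFunctional_apply, map_mul, map_star, ContinuousLinearMap.star_eq_adjoint,
      mul_apply_eq_comp, ContinuousLinearMap.adjoint_inner_right,
      inner_self_eq_norm_sq_to_K]
    rw [← RCLike.ofReal_pow]
    exact Complex.zero_le_real.2 (sq_nonneg ‖regularRep σ a (stdBasis G 0)‖)
  map_one' := canonicalFunctional_W_zero σ
  trace' := canonicalFunctional_mul_comm σ

/-- A character rescales each `W x`; the functional sees only `W 0`, where the factor is 1. -/
theorem canonicalFunctional_dualHom (χ : AddChar G Circle) (a : TwistedGroupCStar σ) :
    canonicalFunctional σ (dualHom χ a) = canonicalFunctional σ a := by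
  have hc : Continuous (dualHom (σ := σ) χ) :=
    AddMonoidHomClass.continuous_of_bound (dualHom χ) 1 fun a => by
      simpa only [one_mul] using NonUnitalStarAlgHom.norm_apply_le (dualHom χ) a
  refine induction_W a (isClosed_eq (by fun_prop) (by fun_prop)) (by rw [map_zero])
    (fun a b ha hb => by rw [map_add, map_add, map_add, ha, hb])
    (fun c a ha => by rw [map_smul, map_smul, map_smul, ha]) fun x => ?_
  rw [dualHom_W, map_smul]
  by_cases hx : x = 0
  · rw [hx, AddChar.map_zero_eq_one, Circle.coe_one, one_smul]
  · rw [canonicalFunctional_W_of_ne_zero σ hx, smul_zero]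

end

/-! ### Uniqueness of the trace over an abelian group -/

section

variable {G : Type*} [AddCommGroup G] {σ : Multiplier G}

theorem smul_W_mul_comm (x y : G) :
    (σ x y : ℂ) • (W σ y * W σ x) = (σ y x : ℂ) • (W σ x * W σ y) := by
  rw [W_mul, W_mul, smul_smul, smul_smul, add_comm, mul_comm]

/-- Since `x + y = y + x`, the two products of `W x` and `W y` can differ only in their phases. -/
theorem commute_W_of_symmetric {x : G} (h : ∀ y, σ x y = σ y x) (a : TwistedGroupCStar σ) :
    Commute (W σ x) a := by
  refine induction_W a (isClosed_eq (by fun_prop) (by fun_prop)) (Commute.zero_right _)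
    (fun a b => Commute.add_right) (fun c a ha => ha.smul_right c) fun y => ?_
  rw [commute_iff_eq, W_mul, W_mul, h, add_comm]

/-- Multiplying the commutation relation by `star (W σ y)` and applying `τ` gives `σ x y * τ (W σ x)
= σ y x * τ (W σ x)`, because a trace is unchanged by unitary conjugation. -/
theorem trace_W_eq_zero_of_ne (τ : TracialState (TwistedGroupCStar σ)) {x y : G}
    (h : σ x y ≠ σ y x) : τ (W σ x) = 0 := by
  have h₁ := congrArg (fun a => τ.toContinuousLinearMap (star (W σ y) * a))
    (smul_W_mul_comm (σ := σ) x y)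
  have htr : τ.toContinuousLinearMap (star (W σ y) * (W σ x * W σ y)) =
      τ.toContinuousLinearMap (W σ x) :=
    (τ.trace' (star (W σ y)) (W σ x * W σ y)).trans (congrArg τ.toContinuousLinearMap (by
      rw [mul_assoc, Unitary.mul_star_self_of_mem (W_mem_unitary y), mul_one]))
  simp only [mul_smul_comm, map_smul, htr, smul_eq_mul] at h₁
  rw [← mul_assoc, Unitary.star_mul_self_of_mem (W_mem_unitary y), one_mul] at h₁
  refine (mul_eq_mul_right_iff.1 h₁).resolve_left fun e => h (Circle.ext e)

theorem _root_.IsSimpleCStar.exists_multiplier_ne (hs : IsSimpleCStar (TwistedGroupCStar σ))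
    {x : G} (hx : x ≠ 0) : ∃ y, σ x y ≠ σ y x := by
  by_contra! h
  obtain ⟨c, hc⟩ := hs.exists_eq_algebraMap_of_central (W σ x) (commute_W_of_symmetric h)
  -- The canonical functional takes the value `c` at the scalar `c`, so `c = 0`, while `W σ x` is a
  -- unitary of a nonzero algebra.
  have h₀ := canonicalFunctional_W_of_ne_zero σ hx
  rw [hc, Algebra.algebraMap_eq_smul_one, map_smul, ← W_zero, canonicalFunctional_W_zero,
    smul_eq_mul, mul_one] at h₀
  have := hs.1
  have hu := Unitary.star_mul_self_of_mem (W_mem_unitary (σ := σ) x)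
  rw [hc, h₀, map_zero, mul_zero] at hu
  exact zero_ne_one hu

theorem eq_canonicalTrace_of_isSimpleCStar (hs : IsSimpleCStar (TwistedGroupCStar σ))
    (τ : TracialState (TwistedGroupCStar σ)) : τ = canonicalTrace σ := by
  have h : τ.toContinuousLinearMap = canonicalFunctional σ := functional_ext fun x => by
    by_cases hx : x = 0
    · rw [hx, canonicalFunctional_W_zero]
      exact τ.map_one'
    · obtain ⟨y, hy⟩ := hs.exists_multiplier_ne hx
      rw [canonicalFunctional_W_of_ne_zero σ hx]
      exact trace_W_eq_zero_of_ne τ hy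
  -- The remaining fields of a tracial state are proofs, so equality of the functionals suffices.
  cases τ
  cases h
  rfl

end

end TwistedGroupCStar

/-! ### Application to noncommutative solenoids -/

theorem mainTheorem11 (N : ℕ) [Fact (1 < N)] (α : Xi N) :
    ∃ τ : TracialState (NCSolenoid N α),
      (∀ (s : Solenoid N × Solenoid N) (a : NCSolenoid N α),
        τ (NCSolenoid.dualAction N α s a) = τ a) ∧
      (IsSimpleCStar (NCSolenoid N α) → ∀ τ' : TracialState (NCSolenoid N α), τ' = τ) :=
  ⟨TwistedGroupCStar.canonicalTrace (Xi.Psi α),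
    -- The trace is invariant under every character, so it is enough that each solenoid pair acts
    -- through the character `Solenoid.pairing₂ s`; that all characters arise this way plays no
    -- role.
    fun s a => TwistedGroupCStar.canonicalFunctional_dualHom (Xi.Psi α) (Solenoid.pairing₂ s) a,
    fun hs τ' => TwistedGroupCStar.eq_canonicalTrace_of_isSimpleCStar hs τ'⟩
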